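/- Let $M\ge 3$ and let $\mathbb B=\{x\in\mathbb R^M : |x|<1\}$ be the open unit ball of $\mathbb R^M$. A *convex polytope* here means a bounded set of the form $P=\bigcap_{i=1}^n\{y\in\mathbb R^M : \langle y,x_i\rangle\le 1\}$ with $x_1,\dots,x_n\in\mathbb R^M\setminus\{0\}$ (that is, the convex hull of a finite set, containing the origin in its interior). A *face* of $P$ is a convex subset $F\subset P$ such that every closed segment with endpoints in $P$ whose relative interior meets $F$ is contained in $F$; a *facet* is a face whose affine hull has dimension $M-1$. The *skeleton* $\operatorname{skel}(P)$ (the $(M-2)$-skeleton, i.e. the union of all $(M-2)$-dimensional faces of $P$) is what remains of the boundary of $P$ after removing the relative interiors of all facets of $P$. Theorem 2.1. There is a sequence of convex polytopes $P_n$, $n\in\mathbb N$, such that $$P_1\subset \operatorname{Int}P_2\subset P_2\subset \operatorname{Int}P_3\subset\cdots\subset\mathbb B,\qquad \bigcup_{j=1}^\infty P_j=\mathbb B,$$ and such that, whenever $w_j\in\operatorname{skel}(P_j)$ for every $j\in\mathbb N$, the series diverges: $$\sum_{j=1}^\infty |w_{j+1}-w_j|=\infty .$$ -/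

import Mathlib

/-- A convex polytope in a real inner product space (with the origin in its interior): a bounded
set that is the intersection of finitely many closed half-spaces `{y | ⟪y, x⟫ ≤ 1}`, `x ≠ 0`. -/
def IsConvexPolytope {E : Type*} [NormedAddCommGroup E] [InnerProductSpace ℝ E]
    (P : Set E) : Prop :=
  Bornology.IsBounded P ∧
    ∃ s : Finset E, (∀ x ∈ s, x ≠ 0) ∧ P = ⋂ x ∈ s, {y : E | inner ℝ y x ≤ 1}

/-- A face of a convex set `P`: a convex subset `F` of `P` such that a segment with endpoints in
`P` whose relative interior meets `F` is contained in `F` (for a convex `F` this means that the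
endpoints of the segment lie in `F`). -/
def IsFace {E : Type*} [NormedAddCommGroup E] [InnerProductSpace ℝ E] (P F : Set E) : Prop :=
  Convex ℝ F ∧ IsExtreme ℝ P F

/-- A facet of a convex set `P`: a face whose affine hull has codimension one. -/
def IsFacet {E : Type*} [NormedAddCommGroup E] [InnerProductSpace ℝ E] (P F : Set E) : Prop :=
  IsFace P F ∧
    Module.finrank ℝ (affineSpan ℝ F).direction + 1 = Module.finrank ℝ E

/-- The skeleton of a convex polytope `P`: what remains of the boundary of `P` after removing
the relative interiors of all facets. -/
def skel {E : Type*} [NormedAddCommGroup E] [InnerProductSpace ℝ E] (P : Set E) : Set E :=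
  frontier P \ ⋃ F ∈ {F : Set E | IsFacet P F}, intrinsicInterior ℝ F

/-! Let each polytope be circumscribed about a sphere of radius `r n = 1 - 1/(n+2)`, touching it in
the directions of an `s`-separated `s`-net. A skeleton point has two tight constraints; their net
points are its nearest ones and lie `s` apart, so its radial projection stays `s/2` away from the
whole net (`half_le_dist_of_mem_skel`). At every scale, `K` such nets, with `K` depending only on
the dimension, have an `s/4`-net as union (`exists_isSphereNet_family`). Use them in turn on a block
of `K` polytopes: the projection of the block's first `w` is `s/4`-close to a point of some net,
which the `w` of that net's polytope must avoid by `s/2`. So the path has length at least a constant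
times `s` in each block. Nesting only needs `s ^ 2` of the order of the gap between radii, about
`1/n ^ 2`. Hence `s` may be of order `1/n`, and the block sums dominate a harmonic series. -/

open Metric

/-! ### Circumscribed polytopes and their skeletons -/

section Polytope

variable {E : Type*} [NormedAddCommGroup E] [InnerProductSpace ℝ E]

/-- The intersection of the half-spaces `{y | ⟪y, u⟫ ≤ r}` with `u ∈ S`. -/
def tangentPolytope (r : ℝ) (S : Finset E) : Set E := {y | ∀ u ∈ S, inner ℝ y u ≤ r}

/-- A finite set of unit vectors with mutual distances at least `s` that meets every open ball of
radius `s` centred on the unit sphere. -/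
structure IsSphereNet (s : ℝ) (S : Finset E) : Prop where
  norm_eq_one : ∀ u ∈ S, ‖u‖ = 1
  le_dist : ∀ u ∈ S, ∀ v ∈ S, u ≠ v → s ≤ dist u v
  exists_dist_lt : ∀ v : E, ‖v‖ = 1 → ∃ u ∈ S, dist v u < s

theorem isClosed_tangentPolytope (r : ℝ) (S : Finset E) : IsClosed (tangentPolytope r S) := by
  have h : tangentPolytope r S = ⋂ u ∈ S, {y : E | inner ℝ y u ≤ r} := by
    ext y; simp [tangentPolytope]
  rw [h]
  exact isClosed_biInter fun u _ => isClosed_le (by fun_prop) continuous_const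

theorem isOpen_setOf_forall_inner_lt (r : ℝ) (S : Finset E) :
    IsOpen {y : E | ∀ u ∈ S, inner ℝ y u < r} := by
  have h : {y : E | ∀ u ∈ S, inner ℝ y u < r} = ⋂ u ∈ S, {y : E | inner ℝ y u < r} := by
    ext y; simp
  rw [h]
  exact isOpen_biInter_finset fun u _ => isOpen_lt (by fun_prop) continuous_const

theorem isFace_tangentPolytope {r : ℝ} {S : Finset E} {u : E} (hu : u ∈ S) :
    IsFace (tangentPolytope r S) {y | y ∈ tangentPolytope r S ∧ inner ℝ y u = r} := by
  refine ⟨?_, ⟨fun y hy => hy.1, ?_⟩⟩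
  · intro x hx y hy a b ha hb hab
    refine ⟨fun t ht => ?_, ?_⟩
    · rw [inner_add_left, real_inner_smul_left, real_inner_smul_left]
      calc a * inner ℝ x t + b * inner ℝ y t ≤ a * r + b * r :=
            add_le_add (mul_le_mul_of_nonneg_left (hx.1 t ht) ha)
              (mul_le_mul_of_nonneg_left (hy.1 t ht) hb)
        _ = r := by rw [← add_mul, hab, one_mul]
    · rw [inner_add_left, real_inner_smul_left, real_inner_smul_left, hx.2, hy.2, ← add_mul, hab,
        one_mul]
  · rintro x hx y hy z hz ⟨a, b, ha, hb, hab, rfl⟩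
    refine ⟨hx, ?_⟩
    have h := hz.2
    rw [inner_add_left, real_inner_smul_left, real_inner_smul_left] at h
    have hxu := hx u hu
    have hyu := hy u hu
    have hb' : b = 1 - a := by linarith
    subst hb'
    refine le_antisymm hxu ?_
    have h1 : (1 - a) * inner ℝ y u ≤ (1 - a) * r := mul_le_mul_of_nonneg_left hyu hb.le
    exact le_of_mul_le_mul_left (by linarith : a * r ≤ a * inner ℝ x u) ha

/-- A point at which exactly one of the defining constraints is tight lies in the relative interior
of the facet cut out by that constraint. -/
theorem mem_facet_of_unique_tight [FiniteDimensional ℝ E] {r : ℝ} {S : Finset E} {y u : E}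
    (hu : u ∈ S) (hu0 : u ≠ 0) (hyu : inner ℝ y u = r)
    (h : ∀ t ∈ S, t ≠ u → inner ℝ y t < r) :
    ∃ F, IsFacet (tangentPolytope r S) F ∧ y ∈ intrinsicInterior ℝ F := by
  classical
  set F : Set E := {z | z ∈ tangentPolytope r S ∧ inner ℝ z u = r} with hF
  set U : Set E := {z | ∀ t ∈ S.erase u, inner ℝ z t < r} with hU
  have hUo : IsOpen U := isOpen_setOf_forall_inner_lt r _
  have hyU : y ∈ U := fun t ht => h t (Finset.mem_of_mem_erase ht) (Finset.ne_of_mem_erase ht)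
  have hUF : ∀ z ∈ U, inner ℝ z u = r → z ∈ F := by
    intro z hz hzu
    refine ⟨fun t ht => ?_, hzu⟩
    by_cases htu : t = u
    · rw [htu, hzu]
    · exact (hz t (Finset.mem_erase.2 ⟨htu, ht⟩)).le
  have hyF : y ∈ F := hUF y hyU hyu
  have hdir : (affineSpan ℝ F).direction = (ℝ ∙ u)ᗮ := by
    rw [direction_affineSpan]
    apply le_antisymm
    · rw [vectorSpan_def, Submodule.span_le]
      rintro _ ⟨a, ha, b, hb, rfl⟩
      simp only [SetLike.mem_coe, vsub_eq_sub, Submodule.mem_orthogonal_singleton_iff_inner_left]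
      rw [inner_sub_left, ha.2, hb.2, sub_self]
    -- A short step along `v` keeps the slack constraints strict and the tight one tight.
    · intro v hv
      rw [Submodule.mem_orthogonal_singleton_iff_inner_left] at hv
      have hcont : Continuous fun c : ℝ => y + c • v := by fun_prop
      have hnhds : {c : ℝ | y + c • v ∈ U} ∈ nhds (0 : ℝ) :=
        (hUo.preimage hcont).mem_nhds (by simpa using hyU)
      obtain ⟨ε, hε, hball⟩ := Metric.mem_nhds_iff.1 hnhds
      have hmem : y + (ε / 2) • v ∈ U := by
        refine hball ?_
        rw [mem_ball, dist_zero_right, Real.norm_of_nonneg (by positivity)]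
        linarith
      have hmF : y + (ε / 2) • v ∈ F := by
        refine hUF _ hmem ?_
        rw [inner_add_left, real_inner_smul_left, hv, mul_zero, add_zero, hyu]
      have hd := vsub_mem_vectorSpan ℝ hmF hyF
      rw [vsub_eq_sub, add_sub_cancel_left] at hd
      have := Submodule.smul_mem (vectorSpan ℝ F) (ε / 2)⁻¹ hd
      rwa [smul_smul, inv_mul_cancel₀ (by positivity), one_smul] at this
  refine ⟨F, ⟨isFace_tangentPolytope hu, ?_⟩, ?_⟩
  · rw [hdir]
    have := (ℝ ∙ u).finrank_add_finrank_orthogonal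
    rw [finrank_span_singleton hu0] at this
    omega
  · rw [mem_intrinsicInterior]
    refine ⟨⟨y, subset_affineSpan ℝ F hyF⟩, ?_, rfl⟩
    rw [mem_interior]
    refine ⟨((↑) : affineSpan ℝ F → E) ⁻¹' U, ?_, hUo.preimage continuous_subtype_val, hyU⟩
    rintro ⟨z, hz⟩ hzU
    refine hUF z hzU ?_
    have hzy := AffineSubspace.vsub_mem_direction hz (subset_affineSpan ℝ F hyF)
    rw [hdir, Submodule.mem_orthogonal_singleton_iff_inner_left, vsub_eq_sub, inner_sub_left,
      hyu] at hzy
    linarith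

theorem exists_two_tight_of_mem_skel [FiniteDimensional ℝ E] {r : ℝ} {S : Finset E}
    (hS : ∀ u ∈ S, u ≠ 0) {y : E} (hy : y ∈ skel (tangentPolytope r S)) :
    y ∈ tangentPolytope r S ∧
      ∃ u ∈ S, ∃ v ∈ S, u ≠ v ∧ inner ℝ y u = r ∧ inner ℝ y v = r := by
  obtain ⟨hfr, hnot⟩ := hy
  have hyP : y ∈ tangentPolytope r S := (isClosed_tangentPolytope r S).frontier_subset hfr
  refine ⟨hyP, ?_⟩
  obtain ⟨u, hu, hyu⟩ : ∃ u ∈ S, inner ℝ y u = r := by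
    by_contra! hne
    refine hfr.2 (mem_interior.2 ⟨_, ?_, isOpen_setOf_forall_inner_lt r S,
      fun u hu => lt_of_le_of_ne (hyP u hu) (hne u hu)⟩)
    exact fun z hz u hu => (hz u hu).le
  by_contra! hne
  obtain ⟨F, hF, hyF⟩ := mem_facet_of_unique_tight hu (hS u hu) hyu
    fun t ht htu => lt_of_le_of_ne (hyP t ht) (hne u hu t ht htu.symm hyu)
  exact hnot (Set.mem_iUnion₂.2 ⟨F, hF, hyF⟩)

theorem norm_sub_sq_of_norm_eq_one {x y : E} (hx : ‖x‖ = 1) (hy : ‖y‖ = 1) :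
    ‖x - y‖ ^ 2 = 2 - 2 * inner ℝ x y := by
  rw [norm_sub_sq_real, hx, hy]; ring

theorem norm_inv_norm_smul_self {y : E} (hy : y ≠ 0) : ‖‖y‖⁻¹ • y‖ = 1 := by
  rw [norm_smul, norm_inv, norm_norm, inv_mul_cancel₀ (norm_ne_zero_iff.2 hy)]

theorem dist_inv_norm_smul_le {x y : E} (hx : 1 / 2 ≤ ‖x‖) (hy : y ≠ 0) :
    dist (‖x‖⁻¹ • x) (‖y‖⁻¹ • y) ≤ 4 * dist x y := by
  have hx0 : 0 < ‖x‖ := by linarith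
  have hy0 : 0 < ‖y‖ := norm_pos_iff.2 hy
  have h1 : ‖x‖⁻¹ • x - ‖y‖⁻¹ • y = ‖x‖⁻¹ • (x - y) + (‖x‖⁻¹ * (‖y‖ - ‖x‖)) • (‖y‖⁻¹ • y) := by
    rw [smul_smul, smul_sub, sub_add_eq_add_sub, add_sub_assoc, ← sub_smul, sub_eq_add_neg _ (_ • y),
      ← neg_smul]
    congr 2
    field_simp
    ring
  have hinv : ‖x‖⁻¹ ≤ 2 := by
    rw [inv_le_comm₀ hx0 two_pos]; linarith
  rw [dist_eq_norm, h1]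
  calc ‖‖x‖⁻¹ • (x - y) + (‖x‖⁻¹ * (‖y‖ - ‖x‖)) • (‖y‖⁻¹ • y)‖
      ≤ ‖‖x‖⁻¹ • (x - y)‖ + ‖(‖x‖⁻¹ * (‖y‖ - ‖x‖)) • (‖y‖⁻¹ • y)‖ := norm_add_le _ _
    _ = ‖x‖⁻¹ * ‖x - y‖ + ‖x‖⁻¹ * |‖y‖ - ‖x‖| := by
        rw [norm_smul, norm_smul, norm_inv_norm_smul_self hy, mul_one, norm_mul, norm_inv,
          norm_norm, Real.norm_eq_abs]
    _ ≤ ‖x‖⁻¹ * ‖x - y‖ + ‖x‖⁻¹ * ‖x - y‖ := by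
        gcongr
        rw [abs_sub_comm]
        exact abs_norm_sub_norm_le x y
    _ ≤ 4 * dist x y := by
        rw [dist_eq_norm]
        nlinarith [mul_le_mul_of_nonneg_right hinv (norm_nonneg (x - y))]

namespace IsSphereNet

variable {s r : ℝ} {S : Finset E}

theorem ne_zero {F : Type*} [NormedAddCommGroup F] {S : Finset F} (hS : IsSphereNet s S) {u : F}
    (hu : u ∈ S) : u ≠ 0 := by
  rw [← norm_ne_zero_iff, hS.norm_eq_one u hu]
  exact one_ne_zero

theorem closedBall_subset (hS : IsSphereNet s S) (r : ℝ) :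
    closedBall 0 r ⊆ tangentPolytope r S := by
  intro y hy u hu
  rw [mem_closedBall_zero_iff] at hy
  calc inner ℝ y u ≤ ‖y‖ * ‖u‖ := real_inner_le_norm y u
    _ ≤ r := by rwa [hS.norm_eq_one u hu, mul_one]

/-- Some net point within `s` of the direction of `y` has inner product at least `1 - s ^ 2 / 2`
with it. The error is quadratic in `s`, which is what permits scales of order `1/n`. -/
theorem norm_mul_le (hS : IsSphereNet s S) (hr : 0 ≤ r) {y : E} (hy : y ∈ tangentPolytope r S) :
    ‖y‖ * (1 - s ^ 2 / 2) ≤ r := by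
  by_cases hy0 : y = 0
  · simpa [hy0] using hr
  have hv := norm_inv_norm_smul_self hy0
  obtain ⟨u, hu, hus⟩ := hS.exists_dist_lt _ hv
  have hyu := hy u hu
  have hsq := norm_sub_sq_of_norm_eq_one hv (hS.norm_eq_one u hu)
  rw [dist_eq_norm] at hus
  have h1 : 2 - 2 * inner ℝ (‖y‖⁻¹ • y) u ≤ s ^ 2 := by
    rw [← hsq]; exact pow_le_pow_left₀ (norm_nonneg _) hus.le 2
  have h2 : ‖y‖ * inner ℝ (‖y‖⁻¹ • y) u = inner ℝ y u := by
    rw [real_inner_smul_left, ← mul_assoc, mul_inv_cancel₀ (norm_ne_zero_iff.2 hy0), one_mul]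
  calc ‖y‖ * (1 - s ^ 2 / 2) ≤ ‖y‖ * inner ℝ (‖y‖⁻¹ • y) u :=
        mul_le_mul_of_nonneg_left (by linarith) (norm_nonneg y)
    _ ≤ r := h2 ▸ hyu

theorem subset_ball (hS : IsSphereNet s S) (hr : 0 ≤ r) {R : ℝ} (hs : s ^ 2 < 2)
    (hrR : r < R * (1 - s ^ 2 / 2)) : tangentPolytope r S ⊆ ball 0 R := by
  intro y hy
  rw [mem_ball_zero_iff]
  exact lt_of_mul_lt_mul_right ((hS.norm_mul_le hr hy).trans_lt hrR) (by linarith)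

theorem isConvexPolytope (hS : IsSphereNet s S) (hs : s ^ 2 < 2) (hr : 0 < r) :
    IsConvexPolytope (tangentPolytope r S) := by
  classical
  refine ⟨?_, S.image (r⁻¹ • ·), ?_, ?_⟩
  · have hpos : 0 < 1 - s ^ 2 / 2 := by linarith
    refine isBounded_ball.subset (hS.subset_ball (R := r / (1 - s ^ 2 / 2) + 1) hr.le hs ?_)
    rw [add_mul, div_mul_cancel₀ _ hpos.ne']
    linarith
  · intro x hx
    obtain ⟨u, hu, rfl⟩ := Finset.mem_image.1 hx
    exact smul_ne_zero (inv_ne_zero hr.ne') (hS.ne_zero hu)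
  · ext y
    simp only [tangentPolytope, Set.mem_ofPred_eq, Set.mem_iInter, Finset.forall_mem_image]
    refine forall₂_congr fun u _ => ?_
    rw [real_inner_smul_right, inv_mul_le_iff₀ hr, mul_one]

/-- The radial projection of the skeleton stays away from the net: a skeleton point has two nearest
net points, which are far from each other. -/
theorem half_le_dist_of_mem_skel [FiniteDimensional ℝ E] (hS : IsSphereNet s S) (hr : 0 < r)
    {y : E} (hy : y ∈ skel (tangentPolytope r S)) :
    r ≤ ‖y‖ ∧ ∀ t ∈ S, s / 2 ≤ dist (‖y‖⁻¹ • y) t := by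
  obtain ⟨hyP, u, hu, v, hv, huv, hyu, hyv⟩ :=
    exists_two_tight_of_mem_skel (fun u hu => hS.ne_zero hu) hy
  have hry : r ≤ ‖y‖ := by
    calc r = inner ℝ y u := hyu.symm
      _ ≤ ‖y‖ * ‖u‖ := real_inner_le_norm y u
      _ = ‖y‖ := by rw [hS.norm_eq_one u hu, mul_one]
  refine ⟨hry, fun t ht => ?_⟩
  have hy0 : y ≠ 0 := norm_pos_iff.1 (hr.trans_le hry)
  have hx := norm_inv_norm_smul_self hy0
  have key : ∀ w ∈ S, inner ℝ y w = r → dist (‖y‖⁻¹ • y) w ≤ dist (‖y‖⁻¹ • y) t := by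
    intro w hw hyw
    rw [dist_eq_norm, dist_eq_norm]
    refine le_of_sq_le_sq ?_ (norm_nonneg _)
    rw [norm_sub_sq_of_norm_eq_one hx (hS.norm_eq_one w hw),
      norm_sub_sq_of_norm_eq_one hx (hS.norm_eq_one t ht), real_inner_smul_left,
      real_inner_smul_left, hyw]
    have := mul_le_mul_of_nonneg_left (hyP t ht) (inv_nonneg.2 (norm_nonneg y))
    linarith
  have h1 := hS.le_dist u hu v hv huv
  have h2 := dist_triangle_left u v (‖y‖⁻¹ • y)
  linarith [key u hu hyu, key v hv hyv]

end IsSphereNet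

end Polytope

/-! ### Separated nets on the sphere -/

section Nets

/-- A subset of a compact set with uniformly separated points is finite. -/
theorem IsCompact.finite_of_pairwise_le_dist {X : Type*} [PseudoMetricSpace X] {A N : Set X}
    (hA : IsCompact A) {s : ℝ} (hs : 0 < s) (hNA : N ⊆ A)
    (hN : N.Pairwise fun x y => s ≤ dist x y) : N.Finite := by
  obtain ⟨t, -, htf, htc⟩ := hA.finite_cover_balls (half_pos hs)
  have hchoose : ∀ x ∈ N, ∃ c ∈ t, dist x c < s / 2 := fun x hx => by
    simpa using htc (hNA hx)
  choose! f hft hfd using hchoose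
  refine Set.Finite.of_finite_image (htf.subset (Set.image_subset_iff.2 hft)) ?_
  intro x hx y hy hxy
  by_contra hne
  have h1 := hN hx hy hne
  have h2 := dist_triangle_right x y (f x)
  have h3 := hfd x hx
  have h4 := hfd y hy
  rw [← hxy] at h4
  linarith

/-- A maximal separated set is a net, since an uncovered point could be added. -/
theorem exists_isSphereNet_superset {E : Type*} [NormedAddCommGroup E] [InnerProductSpace ℝ E]
    [FiniteDimensional ℝ E] {s : ℝ} (hs : 0 < s) {T : Set E} (hT1 : ∀ t ∈ T, ‖t‖ = 1)
    (hT : T.Pairwise fun x y => s ≤ dist x y) :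
    ∃ S : Finset E, IsSphereNet s S ∧ T ⊆ S := by
  have := FiniteDimensional.proper_real E
  obtain ⟨N, hTN, hmax⟩ := zorn_subset_nonempty
    {N : Set E | N ⊆ sphere 0 1 ∧ N.Pairwise fun x y => s ≤ dist x y}
    (fun c hc hchain _ => ⟨⋃₀ c, ⟨Set.sUnion_subset fun N hN => (hc hN).1,
      (Set.pairwise_sUnion hchain.directedOn).2 fun N hN => (hc hN).2⟩,
      fun N hN => Set.subset_sUnion_of_mem hN⟩)
    T ⟨fun t ht => mem_sphere_zero_iff_norm.2 (hT1 t ht), hT⟩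
  have hNS : N ⊆ sphere 0 1 := hmax.prop.1
  have hNs : N.Pairwise fun x y => s ≤ dist x y := hmax.prop.2
  have hfin : N.Finite := (isCompact_sphere (0 : E) 1).finite_of_pairwise_le_dist hs hNS hNs
  refine ⟨hfin.toFinset, ⟨?_, ?_, ?_⟩, by simpa using hTN⟩
  · intro u hu
    exact mem_sphere_zero_iff_norm.1 (hNS (hfin.mem_toFinset.1 hu))
  · intro u hu v hv huv
    exact hNs (hfin.mem_toFinset.1 hu) (hfin.mem_toFinset.1 hv) huv
  · intro v hv
    by_contra! hne
    have hfar : ∀ u ∈ N, s ≤ dist v u := fun u hu => hne u (hfin.mem_toFinset.2 hu)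
    have hins : insert v N ⊆ N := by
      refine hmax.le_of_ge ⟨Set.insert_subset (mem_sphere_zero_iff_norm.2 hv) hNS, ?_⟩
        (Set.subset_insert v N)
      refine hNs.insert fun u hu _ => ⟨hfar u hu, ?_⟩
      rw [dist_comm]
      exact hfar u hu
    have := hfar v (hins (Set.mem_insert v N))
    rw [dist_self] at this
    linarith

theorem floor_div_eq_imp_abs_sub_le {a b η : ℝ} (hη : 0 < η) (h : ⌊a / η⌋ = ⌊b / η⌋) :
    |a - b| ≤ η := by
  have := (Int.abs_sub_lt_one_of_floor_eq_floor h).le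
  rwa [← sub_div, abs_div, abs_of_pos hη, div_le_one hη] at this

theorem le_abs_sub_of_floor_div_modEq {a b η : ℝ} {m : ℕ} (hη : 0 < η)
    (hne : ⌊a / η⌋ ≠ ⌊b / η⌋) (h : ((⌊a / η⌋ : ℤ) : ZMod m) = (⌊b / η⌋ : ℤ)) :
    (m - 1) * η ≤ |a - b| := by
  have hdvd : (m : ℤ) ∣ ⌊a / η⌋ - ⌊b / η⌋ :=
    (ZMod.intCast_eq_intCast_iff_dvd_sub _ _ m).1 h.symm
  have hm : (m : ℤ) ≤ |⌊a / η⌋ - ⌊b / η⌋| :=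
    Int.le_of_dvd (abs_pos.2 (sub_ne_zero.2 hne)) ((dvd_abs _ _).2 hdvd)
  have hm' : (m : ℝ) ≤ |(⌊a / η⌋ : ℝ) - ⌊b / η⌋| := by exact_mod_cast hm
  have h1 : |(⌊a / η⌋ : ℝ) - ⌊b / η⌋| ≤ |a / η - b / η| + 1 := by
    have ha := Int.floor_le (a / η)
    have ha' := Int.lt_floor_add_one (a / η)
    have hb := Int.floor_le (b / η)
    have hb' := Int.lt_floor_add_one (b / η)
    have := le_abs_self (a / η - b / η)
    have := neg_abs_le (a / η - b / η)
    rw [abs_le]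
    constructor <;> linarith
  rw [← sub_div, abs_div, abs_of_pos hη] at h1
  rw [← le_div_iff₀ hη]
  linarith

theorem EuclideanSpace.norm_le_card_mul {ι : Type*} [Fintype ι] {x : EuclideanSpace ℝ ι} {η : ℝ}
    (h : ∀ i, |x i| ≤ η) (hη : 0 ≤ η) : ‖x‖ ≤ Fintype.card ι * η := by
  rw [EuclideanSpace.norm_eq]
  refine Real.sqrt_le_iff.2 ⟨by positivity, ?_⟩
  calc ∑ i, ‖x i‖ ^ 2 ≤ ∑ _i : ι, η ^ 2 :=
        Finset.sum_le_sum fun i _ => pow_le_pow_left₀ (norm_nonneg _) (h i) 2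
    _ = Fintype.card ι * η ^ 2 := by simp
    _ ≤ (Fintype.card ι * η) ^ 2 := by
        rw [mul_pow]
        gcongr
        exact_mod_cast Nat.le_self_pow two_ne_zero _

/-- The unit sphere of `ℝ^ι` carries, at every scale `s`, a number of `s`-separated nets that is
independent of `s` and whose union is an `s / 4`-net. -/
theorem exists_isSphereNet_family (ι : Type*) [Fintype ι] [Nonempty ι] :
    ∃ K : ℕ, 0 < K ∧ ∀ s : ℝ, 0 < s → ∃ S : ℕ → Finset (EuclideanSpace ℝ ι),
      (∀ c, IsSphereNet s (S c)) ∧ ∀ v, ‖v‖ = 1 → ∃ c < K, ∃ t ∈ S c, dist v t ≤ s / 4 := by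
  classical
  set d := Fintype.card ι with hd
  have hd0 : 0 < d := Fintype.card_pos
  -- Chosen with `η` so that `(m - 1) * η = s`, while a cubical cell of side `η` has diameter at
  -- most `d * η = s / 4`.
  set m := 4 * d + 1 with hm
  have : NeZero m := ⟨by omega⟩
  let e := Fintype.equivFin (ι → ZMod m)
  refine ⟨Fintype.card (ι → ZMod m), Fintype.card_pos, fun s hs => ?_⟩
  set η := s / (4 * d) with hηdef
  have hη : 0 < η := by positivity
  have hdη : d * η = s / 4 := by rw [hηdef]; field_simp
  let cell : EuclideanSpace ℝ ι → ι → ℤ := fun x i => ⌊x i / η⌋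
  -- One representative on the sphere per cell; cells are coloured by their coordinates mod `m`, so
  -- distinct cells of one colour are far apart.
  let f : EuclideanSpace ℝ ι → EuclideanSpace ℝ ι :=
    fun x => Function.invFunOn cell (sphere 0 1) (cell x)
  have hf1 : ∀ x ∈ sphere (0 : EuclideanSpace ℝ ι) 1, ‖f x‖ = 1 := fun x hx =>
    mem_sphere_zero_iff_norm.1 (Function.invFunOn_apply_mem hx)
  have hfcell : ∀ x ∈ sphere (0 : EuclideanSpace ℝ ι) 1, cell (f x) = cell x := fun x hx =>
    Function.invFunOn_apply_eq hx
  let color : EuclideanSpace ℝ ι → ℕ := fun x => e fun i => (cell x i : ZMod m)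
  let T : ℕ → Set (EuclideanSpace ℝ ι) := fun c => f '' {x | x ∈ sphere 0 1 ∧ color x = c}
  have hT1 : ∀ c, ∀ t ∈ T c, ‖t‖ = 1 := by
    rintro c _ ⟨x, hx, rfl⟩
    exact hf1 x hx.1
  have hTs : ∀ c, (T c).Pairwise fun x y => s ≤ dist x y := by
    rintro c _ ⟨x, ⟨hx, hxc⟩, rfl⟩ _ ⟨y, ⟨hy, hyc⟩, rfl⟩ hne
    have hcell : cell x ≠ cell y := fun h => hne (by simp only [f, h])
    obtain ⟨i, hi⟩ := Function.ne_iff.1 hcell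
    have hcol : (fun i => (cell x i : ZMod m)) = fun i => (cell y i : ZMod m) :=
      e.injective (Fin.val_injective (hxc.trans hyc.symm))
    have hcoli := congrFun hcol i
    rw [← hfcell x hx, ← hfcell y hy] at hi hcoli
    calc s = (m - 1) * η := by rw [hm]; push_cast; linarith
      _ ≤ |f x i - f y i| := le_abs_sub_of_floor_div_modEq hη hi hcoli
      _ ≤ dist (f x) (f y) := by
          rw [dist_eq_norm]
          exact PiLp.norm_apply_le (f x - f y) i
  choose S hS hTS using fun c => exists_isSphereNet_superset hs (hT1 c) (hTs c)
  refine ⟨S, hS, fun v hv => ⟨color v, Fin.is_lt _, f v, hTS _ ⟨v, ⟨?_, rfl⟩, rfl⟩, ?_⟩⟩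
  · exact mem_sphere_zero_iff_norm.2 hv
  · rw [dist_eq_norm, ← hdη]
    refine EuclideanSpace.norm_le_card_mul (fun i => ?_) hη.le
    exact floor_div_eq_imp_abs_sub_le hη
      (congrFun (hfcell v (mem_sphere_zero_iff_norm.2 hv)) i).symm

end Nets

/-! ### Divergence and the construction -/

/-- A nonnegative series whose blocks of length `K` dominate a multiple of the harmonic series
diverges. -/
theorem not_summable_of_le_block_sum {a : ℕ → ℝ} (ha : ∀ n, 0 ≤ a n) {K : ℕ} {c d : ℝ}
    (hc : 0 < c) (hd : 0 < d)
    (h : ∀ k : ℕ, c / (k + d) ≤ ∑ i ∈ Finset.range K, a (K * k + i)) : ¬ Summable a := by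
  intro hsum
  have hpart : ∀ N : ℕ, ∑ k ∈ Finset.range N, c / (k + d) ≤ ∑ n ∈ Finset.range (K * N), a n := by
    intro N
    induction N with
    | zero => simp
    | succ N ih =>
      rw [Finset.sum_range_succ, mul_add, mul_one, Finset.sum_range_add]
      exact add_le_add ih (h N)
  have hs : Summable fun k : ℕ => c / (k + d) :=
    summable_of_sum_range_le (fun k => by positivity)
      fun N => (hpart N).trans (hsum.sum_le_tsum _ fun n _ => ha n)
  refine lt_irrefl (1 : ℝ) ((Real.summable_one_div_nat_add_rpow d 1).1 ?_)
  refine (hs.mul_left c⁻¹).congr fun k => ?_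
  rw [Real.rpow_one, abs_of_pos (by positivity)]
  field_simp

theorem theorem2p1 (M : ℕ) (hM : 3 ≤ M) :
    ∃ P : ℕ → Set (EuclideanSpace ℝ (Fin M)),
      (∀ n, IsConvexPolytope (P n)) ∧
      (∀ n, P n ⊆ interior (P (n + 1))) ∧
      (∀ n, P n ⊆ Metric.ball 0 1) ∧
      (⋃ n, P n) = Metric.ball 0 1 ∧
      ∀ w : ℕ → EuclideanSpace ℝ (Fin M), (∀ n, w n ∈ skel (P n)) →
        ¬ Summable (fun n => ‖w (n + 1) - w n‖) := by
  have : Nonempty (Fin M) := ⟨⟨0, by omega⟩⟩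
  obtain ⟨K, hK, hnets⟩ := exists_isSphereNet_family (Fin M)
  -- `K * (k + 1)` bounds every index of block `k`, so one scale serves the whole block.
  let σ : ℕ → ℝ := fun k => 1 / (K * (k + 1) + 2)
  have hσ : ∀ k, 0 < σ k := fun k => by positivity
  choose S hS hcover using fun k => hnets (σ k) (hσ k)
  let r : ℕ → ℝ := fun n => 1 - 1 / (n + 2)
  have hr_half : ∀ n, 1 / 2 ≤ r n := fun n => by
    have : (1 : ℝ) / (n + 2) ≤ 1 / 2 := by gcongr; linarith [(Nat.cast_nonneg n : (0 : ℝ) ≤ n)]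
    simp only [r]; linarith
  have hr_lt : ∀ n, r n < 1 := fun n => by
    have : (0 : ℝ) < 1 / (n + 2) := by positivity
    simp only [r]; linarith
  have hσr : ∀ n, σ (n / K) ≤ 1 / (n + 2) := fun n => by
    have h1 : n ≤ K * (n / K + 1) := by
      have h2 := Nat.div_add_mod n K
      have h3 := Nat.mod_lt n hK
      rw [mul_add]; omega
    have h1' : (n : ℝ) ≤ K * ((n / K : ℕ) + 1) := by exact_mod_cast h1
    simp only [σ]
    gcongr
  have hσ2 : ∀ n, σ (n / K) ^ 2 < 2 := fun n => by
    have h1 : σ (n / K) ≤ 1 := (hσr n).trans (by linarith [hr_half n])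
    nlinarith [hσ (n / K)]
  have hstep : ∀ n, r n < r (n + 1) * (1 - σ (n / K) ^ 2 / 2) := fun n => by
    have h1 : σ (n / K) ^ 2 ≤ (1 / (n + 2)) ^ 2 := pow_le_pow_left₀ (hσ _).le (hσr n) 2
    calc r n < r (n + 1) * (1 - (1 / (n + 2)) ^ 2 / 2) := by
          simp only [r]
          push_cast
          rw [← sub_pos]
          have : (1 - 1 / ((n : ℝ) + 1 + 2)) * (1 - (1 / (n + 2)) ^ 2 / 2) - (1 - 1 / (n + 2)) =
            1 / (2 * (n + 2) * (n + 3)) := by field_simp; ring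
          rw [this]; positivity
      _ ≤ r (n + 1) * (1 - σ (n / K) ^ 2 / 2) :=
          mul_le_mul_of_nonneg_left (by linarith) (by linarith [hr_half (n + 1)])
  let P : ℕ → Set (EuclideanSpace ℝ (Fin M)) := fun n => tangentPolytope (r n) (S (n / K) (n % K))
  have hPball : ∀ n, P n ⊆ ball 0 (r (n + 1)) := fun n =>
    (hS _ _).subset_ball (by linarith [hr_half n]) (hσ2 n) (hstep n)
  have hP1 : ∀ n, P n ⊆ ball 0 1 := fun n =>
    (hPball n).trans (ball_subset_ball (hr_lt (n + 1)).le)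
  refine ⟨P, fun n => (hS _ _).isConvexPolytope (hσ2 n) (by linarith [hr_half n]), fun n => ?_,
    hP1, ?_, fun w hw => ?_⟩
  · exact (hPball n).trans (interior_maximal
      (ball_subset_closedBall.trans ((hS _ _).closedBall_subset _)) isOpen_ball)
  · refine (Set.iUnion_subset hP1).antisymm fun x hx => ?_
    rw [mem_ball_zero_iff] at hx
    obtain ⟨n, hn⟩ := exists_nat_gt (1 / (1 - ‖x‖))
    refine Set.mem_iUnion.2 ⟨n, (hS _ _).closedBall_subset _ (mem_closedBall_zero_iff.2 ?_)⟩
    have h1 : 1 / ((n : ℝ) + 2) ≤ 1 - ‖x‖ := by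
      rw [div_le_iff₀ (by positivity)]
      rw [div_lt_iff₀ (by linarith)] at hn
      nlinarith
    simp only [r]; linarith
  have hskel := fun n => (hS (n / K) (n % K)).half_le_dist_of_mem_skel
    (by linarith [hr_half n] : 0 < r n) (hw n)
  have hwn : ∀ n, 1 / 2 ≤ ‖w n‖ := fun n => (hr_half n).trans (hskel n).1
  have hw0 : ∀ n, w n ≠ 0 := fun n => norm_pos_iff.1 (by linarith [hwn n])
  -- These constants make the required bound equal to `σ k / 16`.
  refine not_summable_of_le_block_sum (K := K) (c := 1 / (16 * K)) (d := 1 + 2 / K)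
    (fun n => norm_nonneg _) (by positivity) (by positivity) fun k => ?_
  have hck : 1 / (16 * (K : ℝ)) / (k + (1 + 2 / K)) = σ k / 16 := by
    simp only [σ]; field_simp; ring
  rw [hck]
  obtain ⟨c, hcK, t, ht, hdist⟩ := hcover k _ (norm_inv_norm_smul_self (hw0 (K * k)))
  have hdiv : (K * k + c) / K = k := by
    rw [Nat.mul_add_div hK, Nat.div_eq_of_lt hcK, add_zero]
  have hmod : (K * k + c) % K = c := by rw [Nat.mul_add_mod, Nat.mod_eq_of_lt hcK]
  have hfar := (hskel (K * k + c)).2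
  rw [hdiv, hmod] at hfar
  have h1 := hfar t ht
  have h2 := dist_inv_norm_smul_le (hwn (K * k + c)) (hw0 (K * k))
  have h3 : dist (w (K * k)) (w (K * k + c)) ≤
      ∑ i ∈ Finset.range K, ‖w (K * k + i + 1) - w (K * k + i)‖ := by
    calc dist (w (K * k)) (w (K * k + c))
        ≤ ∑ i ∈ Finset.range c, dist (w (K * k + i)) (w (K * k + (i + 1))) :=
          dist_le_range_sum_dist (fun i => w (K * k + i)) c
      _ ≤ ∑ i ∈ Finset.range K, dist (w (K * k + i)) (w (K * k + (i + 1))) :=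
          Finset.sum_le_sum_of_subset_of_nonneg (Finset.range_mono hcK.le) fun _ _ _ => dist_nonneg
      _ = _ := Finset.sum_congr rfl fun i _ => by rw [dist_comm, dist_eq_norm, add_assoc]
  -- `σ k / 2 - σ k / 4` of projected motion, divided by the Lipschitz constant 4, gives `σ k / 16`.
  have h4 := dist_triangle (‖w (K * k + c)‖⁻¹ • w (K * k + c)) (‖w (K * k)‖⁻¹ • w (K * k)) t
  rw [dist_comm] at h3
  linarith
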